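/- Let $G$ be a (real, Hausdorff) Lie group of dimension $d$ with neutral element $e$, let $\{X_1,\dots,X_d\}$ be a fixed basis of its Lie algebra, identified with left-invariant vector fields acting on smooth functions, and let $\mathcal F(G)$, $C(G)$, $C_0(G)$ and $C_c^\infty(G)$ be the spaces of all, of continuous, of continuous vanishing at infinity, and of smooth compactly supported real-valued functions on $G$. A canonical coordinate neighbourhood of $e$ is an open set $U\ni e$ together with functions $x_1,\dots,x_d\in C_c^\infty(G)$ such that $x_i(e)=0$, the map $(x_1,\dots,x_d)$ is a homeomorphism of $U$ onto an open subset of $\mathbb R^d$, and $\tau=\exp\big(\sum_i x_i(\tau)X_i\big)$ for $\tau\in U$. Fix one such $U$ with its $x_1,\dots,x_d$. A Borel measure $\mu$ on $G$ is a Lévy measure if $\mu(\{e\})=0$ and, for every canonical coordinate neighbourhood $V$ of $e$ with coordinate functions $y_1,\dots,y_d$, $\int_V\sum_i y_i^2\,d\mu<\infty$ and $\mu(V^c)<\infty$. Let $A:C_c^\infty(G)\to\mathcal F(G)$ be a linear map satisfying the positive maximum principle: if $f\in C_c^\infty(G)$ and $f(\rho)=\sup_{\tau\in G}f(\tau)\ge0$,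 then $Af(\rho)\le0$. Let $c,b_i,a_{jk}:G\to\mathbb R$ ($1\le i,j,k\le d$) with $c\ge0$ and $(a_{jk}(\sigma))$ symmetric and non-negative definite for all $\sigma\in G$, and let $\mu(\sigma,\cdot)$, $\sigma\in G$, be Lévy measures, such that $A$ has the form $$Af(\sigma)=-c(\sigma)f(\sigma)+\sum_{i=1}^d b_i(\sigma)X_if(\sigma)+\sum_{j,k=1}^d a_{jk}(\sigma)X_jX_kf(\sigma)+\int_G\Big(f(\sigma\tau)-f(\sigma)-\sum_{i=1}^d x_i(\tau)X_if(\sigma)\Big)\mu(\sigma,d\tau)$$ for all $f\in C_c^\infty(G)$, $\sigma\in G$. Consider the conditions: (i) the functions $c,b_i,a_{jk}$ are continuous; (ii) for every bounded continuous $h:U\to\mathbb R$ the map $g\mapsto\int_U h(\tau)\sum_{i=1}^d x_i(\tau)^2\,\mu(g,d\tau)$ is continuous on $G$, and for every bounded continuous $k:U^c\to\mathbb R$ the map $g\mapsto\int_{U^c}k(\tau)\,\mu(g,d\tau)$ is continuous on $G$; (iii) $\lim_{\sigma\to\infty}\mu(\sigma,U^c)=0$. Then: if (i) and (ii) hold,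 $Af\in C(G)$ for every $f\in C_c^\infty(G)$; if (iii) holds, $Af$ vanishes at infinity for every $f\in C_c^\infty(G)$; and if (i), (ii) and (iii) hold, $A$ maps $C_c^\infty(G)$ into $C_0(G)$. -/

import Mathlib

open scoped Manifold ContDiff ZeroAtInfty Topology

noncomputable section

namespace LieCourrege

/-- The space `C_c^∞(G)` of smooth compactly supported real functions on a manifold `G` modelled
on `ℝ^d`, as a linear subspace of the space `ℱ(G)` of all real functions. -/
def CcSmooth (d : ℕ) (G : Type*) [TopologicalSpace G]
    [ChartedSpace (EuclideanSpace ℝ (Fin d)) G] : Submodule ℝ (G → ℝ) where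
  carrier := {f | ContMDiff (𝓡 d) 𝓘(ℝ, ℝ) ∞ f ∧ HasCompactSupport f}
  add_mem' := fun hf hg => ⟨hf.1.add hg.1, hf.2.add hg.2⟩
  zero_mem' := ⟨contMDiff_const, HasCompactSupport.zero⟩
  smul_mem' := fun r _ hf => ⟨(contMDiff_const (c := r)).mul hf.1, hf.2.mul_left (f := fun _ => r)⟩

/-- The positive maximum principle for a linear map `A : C_c^∞(G) → ℱ(G)`. -/
def PositiveMaximumPrinciple {d : ℕ} {G : Type*} [TopologicalSpace G]
    [ChartedSpace (EuclideanSpace ℝ (Fin d)) G] (A : CcSmooth d G →ₗ[ℝ] (G → ℝ)) : Prop :=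
  ∀ (f : CcSmooth d G) (ρ : G),
    (∀ τ : G, (f : G → ℝ) τ ≤ (f : G → ℝ) ρ) → 0 ≤ (f : G → ℝ) ρ → A f ρ ≤ 0

section LieGroup

variable {d : ℕ} {G : Type*} [TopologicalSpace G] [ChartedSpace (EuclideanSpace ℝ (Fin d)) G]
  [Group G]

/-- The action of a Lie algebra element `v`, viewed as a left-invariant vector field, on a real
function `f` (meaningful for differentiable `f`). -/
def lieDeriv (v : GroupLieAlgebra (𝓡 d) G) (f : G → ℝ) (g : G) : ℝ :=
  mfderiv (𝓡 d) 𝓘(ℝ, ℝ) f g (mulInvariantVectorField v g)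

/-- `g = exp v`: the integral curve of the left-invariant vector field `v` starting at the neutral
element reaches `g` at time `1`. -/
def IsLieExp (v : GroupLieAlgebra (𝓡 d) G) (g : G) : Prop :=
  ∃ γ : ℝ → G, IsMIntegralCurve (I := 𝓡 d) γ (mulInvariantVectorField v) ∧ γ 0 = 1 ∧ γ 1 = g

/-- `U` is an open canonical coordinate neighbourhood of the neutral element for the basis `X`,
and `x 0, …, x (d - 1)` are functions in `C_c^∞(G)` whose restrictions to `U` are its canonical
coordinates (of the first kind): they form a homeomorphism of `U` onto an open subset of `ℝ^d`,
vanish at the neutral element, and satisfy `g = exp (∑ i, x i g • X i)` for `g ∈ U`. -/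
structure IsCanonicalNhd (X : Module.Basis (Fin d) ℝ (GroupLieAlgebra (𝓡 d) G))
    (U : Set G) (x : Fin d → G → ℝ) : Prop where
  mem_CcSmooth : ∀ i, x i ∈ CcSmooth d G
  one_mem : (1 : G) ∈ U
  chart : ∃ φ : OpenPartialHomeomorph G (Fin d → ℝ), φ.source = U ∧ ∀ g ∈ U, ∀ i, φ g i = x i g
  apply_one : ∀ i, x i 1 = 0
  exp_eq : ∀ g ∈ U, IsLieExp (∑ i, x i g • X i) g

variable [MeasurableSpace G]

/-- Lévy measures on `G`. -/
structure IsLevyMeasure (X : Module.Basis (Fin d) ℝ (GroupLieAlgebra (𝓡 d) G))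
    (μ : MeasureTheory.Measure G) : Prop where
  singleton_one : μ {1} = 0
  lintegral_lt_top : ∀ (U : Set G) (x : Fin d → G → ℝ), IsCanonicalNhd X U x →
    ∫⁻ τ in U, ENNReal.ofReal (∑ i, x i τ ^ 2) ∂μ < ⊤
  compl_lt_top : ∀ (U : Set G) (x : Fin d → G → ℝ), IsCanonicalNhd X U x → μ Uᶜ < ⊤

/-- `H f (g, τ) = f (g τ) - f g - ∑ i, x i τ * X i f g`. -/
def compensated (X : Module.Basis (Fin d) ℝ (GroupLieAlgebra (𝓡 d) G)) (x : Fin d → G → ℝ)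
    (f : G → ℝ) (g τ : G) : ℝ :=
  f (g * τ) - f g - ∑ i, x i τ * lieDeriv (X i) f g

/-- The functions `c`, `b`, `a` and the Lévy kernel `μ` are the coefficients of the linear map `A`
in its Courrège form with respect to the basis `X` and the coordinate functions `x`. -/
structure IsCourregeForm (X : Module.Basis (Fin d) ℝ (GroupLieAlgebra (𝓡 d) G))
    (x : Fin d → G → ℝ) (A : CcSmooth d G →ₗ[ℝ] (G → ℝ))
    (c : G → ℝ) (b : G → Fin d → ℝ) (a : G → Matrix (Fin d) (Fin d) ℝ)
    (μ : G → MeasureTheory.Measure G) : Prop where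
  c_nonneg : ∀ σ, 0 ≤ c σ
  a_posSemidef : ∀ σ, (a σ).PosSemidef
  levy : ∀ σ, IsLevyMeasure X (μ σ)
  apply_eq : ∀ (f : CcSmooth d G) (σ : G),
    A f σ = -c σ * (f : G → ℝ) σ + ∑ i, b σ i * lieDeriv (X i) (f : G → ℝ) σ
      + ∑ j, ∑ k, a σ j k * lieDeriv (X j) (lieDeriv (X k) (f : G → ℝ)) σ
      + ∫ τ, compensated X x (f : G → ℝ) σ τ ∂(μ σ)

/-- Continuity of the coefficient functions. -/
def ContinuousCoefficients (c : G → ℝ) (b : G → Fin d → ℝ)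
    (a : G → Matrix (Fin d) (Fin d) ℝ) : Prop :=
  Continuous c ∧ (∀ i, Continuous fun σ => b σ i) ∧ ∀ i j, Continuous fun σ => a σ i j

/-- Weak continuity of the kernel: `g ↦ ∫_U h(τ) ∑ i, x_i(τ)² μ(g, dτ)` is continuous for every
`h ∈ C_b(U)`, and `g ↦ ∫_{Uᶜ} k(τ) μ(g, dτ)` is continuous for every `k ∈ C_b(Uᶜ)`. Elements of
`C_b(S)` are given by functions on `G` that are continuous and bounded on `S`; their values off
`S` play no role. -/
def WeaklyContinuousKernel (U : Set G) (x : Fin d → G → ℝ)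
    (μ : G → MeasureTheory.Measure G) : Prop :=
  (∀ h : G → ℝ, ContinuousOn h U → (∃ C, ∀ τ ∈ U, |h τ| ≤ C) →
    Continuous fun g => ∫ τ in U, h τ * (∑ i, x i τ ^ 2) ∂(μ g)) ∧
  (∀ k : G → ℝ, ContinuousOn k Uᶜ → (∃ C, ∀ τ ∈ Uᶜ, |k τ| ≤ C) →
    Continuous fun g => ∫ τ in Uᶜ, k τ ∂(μ g))

/-- The mass of the large jumps vanishes at infinity: `μ(σ, Uᶜ) → 0` as `σ → ∞`. -/
def JumpMassVanishes (U : Set G) (μ : G → MeasureTheory.Measure G) : Prop :=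
  Filter.Tendsto (fun σ => μ σ Uᶜ) (Filter.cocompact G) (𝓝 0)

end LieGroup

end LieCourrege

end

open LieCourrege

/-! Continuity: the local part of `A f` is a finite sum of products of continuous functions, so the
integral term is what matters. Its integrand converges uniformly in `τ` as `σ → σ₀`
(`tendstoUniformly_compensated`). On `Uᶜ` this combines with weak continuity of finite measures. On
`U` the measures may be infinite, but Taylor's formula along `t ↦ σ exp(tv)` bounds the integrand by
`C * ∑ i, x i τ ^ 2` uniformly in `σ` (`exists_abs_compensated_le`), and only the weighted measures
are needed (`continuousAt_setIntegral_of_abs_le`).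

Decay: `U` is relatively compact, so for `σ` far out no jump in `U` reaches the support of `f`, and
`|A f σ|` is at most `sup |f|` times `μ(σ, Uᶜ)` (`abs_apply_le`). -/

open LieCourrege MeasureTheory Filter Set

/-! ### Left-invariant derivatives: linearity, support, smoothness, chain rule. -/

section LieDerivative

variable {d : ℕ} {G : Type*} [TopologicalSpace G] [ChartedSpace (EuclideanSpace ℝ (Fin d)) G]
  [Group G]

/-- The Lie derivative at a fixed point is linear in the Lie algebra element. -/
lemma lieDeriv_sum_smul (X : Fin d → GroupLieAlgebra (𝓡 d) G) (r : Fin d → ℝ) (f : G → ℝ) (g : G) :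
    lieDeriv (∑ i, r i • X i) f g = ∑ i, r i * lieDeriv (X i) f g := by
  let D : GroupLieAlgebra (𝓡 d) G →ₗ[ℝ] ℝ :=
    { toFun := fun v => lieDeriv v f g
      map_add' := fun v w => by
        unfold lieDeriv
        rw [mulInvariantVectorField_add]
        exact map_add (mfderiv (𝓡 d) 𝓘(ℝ, ℝ) f g) _ _
      map_smul' := fun r v => by
        unfold lieDeriv
        rw [mulInvariantVectorField_smul]
        exact map_smul (mfderiv (𝓡 d) 𝓘(ℝ, ℝ) f g) _ _ }
  have h := map_sum D (fun i => r i • X i) Finset.univ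
  simp only [map_smul, smul_eq_mul] at h
  exact h

lemma tsupport_lieDeriv_subset (v : GroupLieAlgebra (𝓡 d) G) (f : G → ℝ) :
    tsupport (lieDeriv v f) ⊆ tsupport f := by
  refine closure_minimal (fun g hg => ?_) (isClosed_tsupport f)
  by_contra h
  refine hg ?_
  have h0 : f =ᶠ[𝓝 g] fun _ => 0 := notMem_tsupport_iff_eventuallyEq.1 h
  unfold lieDeriv
  rw [h0.mfderiv_eq, mfderiv_const]
  rfl


lemma hasCompactSupport_lieDeriv {f : G → ℝ} (hf : HasCompactSupport f)
    (v : GroupLieAlgebra (𝓡 d) G) : HasCompactSupport (lieDeriv v f) :=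
  IsCompact.of_isClosed_subset hf (isClosed_tsupport _) (tsupport_lieDeriv_subset v f)

variable [LieGroup (𝓡 d) ∞ G]

/-- The derivative is the fibre component of the tangent map of `f` composed with the invariant
field. The cap `m ≤ 2` is the regularity at which the field is used; it suffices for a second-order
expansion. -/
lemma contMDiff_lieDeriv {m n : ℕ∞ω} (hm : m ≤ 2) (hmn : m + 1 ≤ n) {f : G → ℝ}
    (hf : ContMDiff (𝓡 d) 𝓘(ℝ, ℝ) n f) (v : GroupLieAlgebra (𝓡 d) G) :
    ContMDiff (𝓡 d) 𝓘(ℝ, ℝ) m (lieDeriv v f) := by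
  have : LieGroup (𝓡 d) (minSmoothness ℝ 3) G := by
    rw [minSmoothness_of_isRCLikeNormedField]; infer_instance
  have : IsManifold (𝓡 d) ∞ G := ContMDiffMul.toIsManifold
  have : IsManifold (𝓡 d) 1 G := IsManifold.of_le (n := ∞) (by simp)
  have hV := contMDiff_mulInvariantVectorField (I := 𝓡 d) v
  replace hm : m ≤ minSmoothness ℝ 2 := hm.trans le_minSmoothness
  have hT := hf.contMDiff_tangentMap hmn
  have h2 := (contMDiff_snd_tangentBundle_modelSpace ℝ 𝓘(ℝ, ℝ) (n := m)).comp
    (hT.comp (hV.of_le hm))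
  exact h2

/-- By left invariance, a left translate of an integral curve is again an integral curve. -/
lemma hasDerivAt_comp_mul_integralCurve {f : G → ℝ} (hf : MDifferentiable (𝓡 d) 𝓘(ℝ, ℝ) f)
    {v : GroupLieAlgebra (𝓡 d) G} {γ : ℝ → G}
    (hγ : IsMIntegralCurve (I := 𝓡 d) γ (mulInvariantVectorField v)) (σ : G) (t : ℝ) :
    HasDerivAt (fun s => f (σ * γ s)) (lieDeriv v f (σ * γ t)) t := by
  have : LieGroup (𝓡 d) 1 G := inferInstance
  have hL : ∀ a b : G, MDifferentiableAt (𝓡 d) (𝓡 d) (a * ·) b := fun a b =>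
    (contMDiff_mul_left (I := 𝓡 d) (n := 1)).contMDiffAt.mdifferentiableAt one_ne_zero
  have h1 := (hf (σ * γ t)).hasMFDerivAt
  have h2 := (hL σ (γ t)).hasMFDerivAt
  have hinv : mulInvariantVectorField v (σ * γ t)
      = mfderiv (𝓡 d) (𝓡 d) (σ * ·) (γ t) (mulInvariantVectorField v (γ t)) := by
    -- The base point is generalised because `γ t * 1` and `γ t` agree only propositionally.
    have hσ : ∀ y, y = γ t → HasMFDerivAt (𝓡 d) (𝓡 d) (σ * ·) y
        (mfderiv (𝓡 d) (𝓡 d) (σ * ·) (γ t)) := by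
      rintro _ rfl; exact h2
    have hc := (hσ (γ t * 1) (mul_one _)).comp (1 : G) (hL (γ t) 1).hasMFDerivAt
    have hfun : (σ * ·) ∘ (γ t * ·) = (σ * γ t * ·) := by
      ext x; simp [mul_assoc]
    rw [hfun] at hc
    exact DFunLike.congr_fun hc.mfderiv v
  have h := (h1.comp (γ t) h2).comp t (hγ t)
  have h' : HasFDerivAt (fun s => f (σ * γ s)) _ t := hasMFDerivAt_iff_hasFDerivAt.1 h
  refine (hasDerivAt_iff_hasFDerivAt.2 (h'.congr_fderiv (ContinuousLinearMap.ext fun r => ?_)))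
  unfold lieDeriv
  rw [hinv]
  let T : EuclideanSpace ℝ (Fin d) →L[ℝ] EuclideanSpace ℝ (Fin d) :=
    mfderiv (𝓡 d) (𝓡 d) (σ * ·) (γ t)
  let F : EuclideanSpace ℝ (Fin d) →L[ℝ] ℝ := mfderiv (𝓡 d) 𝓘(ℝ, ℝ) f (σ * γ t)
  let w : EuclideanSpace ℝ (Fin d) := mulInvariantVectorField v (γ t)
  have hlin : ∀ s : ℝ, F (T (s • w)) = s • F (T w) := fun s => by simp
  exact hlin r

end LieDerivative

/-! ### The compensated increment: bounds, uniform continuity, Taylor estimate. -/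

section Compensated

variable {d : ℕ} {G : Type*} [TopologicalSpace G] [ChartedSpace (EuclideanSpace ℝ (Fin d)) G]

lemma exists_bound_of_mem_CcSmooth {f : G → ℝ} (hf : f ∈ CcSmooth d G) :
    ∃ C, ∀ g, |f g| ≤ C := by
  obtain ⟨C, hC⟩ := hf.2.exists_bound_of_continuous hf.1.continuous
  exact ⟨C, hC⟩

variable [Group G]

/-- A function in `C_c(G)` is uniformly continuous with respect to left translations. -/
lemma tendstoUniformly_mul_left [IsTopologicalGroup G] {f : G → ℝ} (hf : Continuous f)
    (hc : HasCompactSupport f) (σ₀ : G) :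
    TendstoUniformly (fun σ τ => f (σ * τ)) (fun τ => f (σ₀ * τ)) (𝓝 σ₀) := by
  -- The right uniformity fits because `(σ * τ) * (σ₀ * τ)⁻¹ = σ * σ₀⁻¹` does not involve `τ`.
  let _ : UniformSpace G := IsTopologicalGroup.rightUniformSpace G
  have hu : UniformContinuous f := hc.uniformContinuous_of_continuous hf
  intro s hs
  have h := hu hs
  rw [mem_map, uniformity_eq_comap_nhds_one', mem_comap] at h
  obtain ⟨t, ht, hts⟩ := h
  have hlim : Tendsto (fun σ : G => σ * σ₀⁻¹) (𝓝 σ₀) (𝓝 1) := by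
    have : Continuous fun σ : G => σ * σ₀⁻¹ := by fun_prop
    simpa using this.tendsto σ₀
  filter_upwards [hlim ht] with σ hσ τ
  refine hts (a := (σ₀ * τ, σ * τ)) ?_
  simpa [mul_assoc] using hσ

/-- Relative compactness of a canonical coordinate neighbourhood. -/
lemma LieCourrege.IsCanonicalNhd.exists_isCompact_superset
    {X : Module.Basis (Fin d) ℝ (GroupLieAlgebra (𝓡 d) G)} {U : Set G} {x : Fin d → G → ℝ}
    (hU : IsCanonicalNhd X U x) : ∃ K, IsCompact K ∧ U ⊆ K := by
  refine ⟨{1} ∪ ⋃ i, tsupport (x i),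
    isCompact_singleton.union (isCompact_iUnion fun i => (hU.mem_CcSmooth i).2), fun g hg => ?_⟩
  obtain ⟨φ, hφ, hφx⟩ := hU.chart
  -- By injectivity of the coordinates, `1` is the only point of `U` where all of them vanish.
  by_cases h : ∀ i, x i g = 0
  · left
    refine φ.injOn (hφ ▸ hg) (hφ ▸ hU.one_mem) (funext fun i => ?_)
    rw [hφx g hg, hφx 1 hU.one_mem, h, hU.apply_one]
  · right
    push Not at h
    obtain ⟨i, hi⟩ := h
    exact mem_iUnion.2 ⟨i, subset_tsupport _ hi⟩

lemma LieCourrege.IsCanonicalNhd.isOpen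
    {X : Module.Basis (Fin d) ℝ (GroupLieAlgebra (𝓡 d) G)} {U : Set G} {x : Fin d → G → ℝ}
    (hU : IsCanonicalNhd X U x) : IsOpen U := by
  obtain ⟨φ, hφ, -⟩ := hU.chart
  exact hφ ▸ φ.open_source

lemma LieCourrege.IsCanonicalNhd.continuous_coord
    {X : Module.Basis (Fin d) ℝ (GroupLieAlgebra (𝓡 d) G)} {U : Set G} {x : Fin d → G → ℝ}
    (hU : IsCanonicalNhd X U x) (i : Fin d) : Continuous (x i) :=
  (hU.mem_CcSmooth i).1.continuous

lemma exists_bound_compensated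
    {X : Module.Basis (Fin d) ℝ (GroupLieAlgebra (𝓡 d) G)} {U : Set G} {x : Fin d → G → ℝ}
    (hU : IsCanonicalNhd X U x) {f : G → ℝ} (hf : f ∈ CcSmooth d G) (σ : G) :
    ∃ C, ∀ τ, |compensated X x f σ τ| ≤ C := by
  obtain ⟨C, hC⟩ := exists_bound_of_mem_CcSmooth hf
  choose B hB using fun i => exists_bound_of_mem_CcSmooth (hU.mem_CcSmooth i)
  refine ⟨C + C + ∑ i, B i * |lieDeriv (X i) f σ|, fun τ => ?_⟩
  refine (abs_sub _ _).trans (add_le_add ((abs_sub _ _).trans (add_le_add (hC _) (hC _))) ?_)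
  refine (Finset.abs_sum_le_sum_abs _ _).trans (Finset.sum_le_sum fun i _ => ?_)
  rw [abs_mul]
  exact mul_le_mul_of_nonneg_right (hB i τ) (abs_nonneg _)

lemma continuous_compensated [IsTopologicalGroup G]
    {X : Module.Basis (Fin d) ℝ (GroupLieAlgebra (𝓡 d) G)} {U : Set G} {x : Fin d → G → ℝ}
    (hU : IsCanonicalNhd X U x) {f : G → ℝ} (hf : f ∈ CcSmooth d G) (σ : G) :
    Continuous (compensated X x f σ) := by
  have h1 := hf.1.continuous
  have h2 := hU.continuous_coord
  unfold compensated
  fun_prop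

variable [LieGroup (𝓡 d) ∞ G]

lemma contMDiff_two_lieDeriv {f : G → ℝ} (hf : f ∈ CcSmooth d G)
    (v : GroupLieAlgebra (𝓡 d) G) : ContMDiff (𝓡 d) 𝓘(ℝ, ℝ) 2 (lieDeriv v f) := by
  refine contMDiff_lieDeriv (n := ∞) le_rfl ?_ hf.1 v
  rw [two_add_one_eq_three]
  exact ENat.LEInfty.out

lemma continuous_lieDeriv {f : G → ℝ} (hf : f ∈ CcSmooth d G)
    (v : GroupLieAlgebra (𝓡 d) G) : Continuous (lieDeriv v f) :=
  (contMDiff_two_lieDeriv hf v).continuous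

lemma continuous_lieDeriv_lieDeriv {f : G → ℝ} (hf : f ∈ CcSmooth d G)
    (v w : GroupLieAlgebra (𝓡 d) G) : Continuous (lieDeriv v (lieDeriv w f)) :=
  (contMDiff_lieDeriv (m := 1) one_le_two (by norm_num [one_add_one_eq_two])
    (contMDiff_two_lieDeriv hf w) v).continuous

lemma tendstoUniformly_compensated [IsTopologicalGroup G]
    {X : Module.Basis (Fin d) ℝ (GroupLieAlgebra (𝓡 d) G)} {U : Set G} {x : Fin d → G → ℝ}
    (hU : IsCanonicalNhd X U x) {f : G → ℝ} (hf : f ∈ CcSmooth d G) (σ₀ : G) :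
    TendstoUniformly (compensated X x f) (compensated X x f σ₀) (𝓝 σ₀) := by
  choose B hB using fun i => exists_bound_of_mem_CcSmooth (hU.mem_CcSmooth i)
  have hrest : Tendsto (fun σ => |f σ₀ - f σ|
      + ∑ i, B i * |lieDeriv (X i) f σ₀ - lieDeriv (X i) f σ|) (𝓝 σ₀) (𝓝 0) := by
    have h1 := hf.1.continuous
    have h2 := fun i => continuous_lieDeriv hf (X i)
    have : Continuous fun σ => |f σ₀ - f σ|
      + ∑ i, B i * |lieDeriv (X i) f σ₀ - lieDeriv (X i) f σ| := by fun_prop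
    simpa using this.tendsto σ₀
  rw [Metric.tendstoUniformly_iff]
  intro ε hε
  filter_upwards [Metric.tendstoUniformly_iff.1
    (tendstoUniformly_mul_left hf.1.continuous hf.2 σ₀) (ε / 2) (half_pos hε),
    hrest.eventually_lt_const (half_pos hε)] with σ h1 h2 τ
  have h1 := h1 τ
  rw [Real.dist_eq] at h1 ⊢
  have hsum : |∑ i, x i τ * (lieDeriv (X i) f σ₀ - lieDeriv (X i) f σ)|
      ≤ ∑ i, B i * |lieDeriv (X i) f σ₀ - lieDeriv (X i) f σ| := by
    refine (Finset.abs_sum_le_sum_abs _ _).trans (Finset.sum_le_sum fun i _ => ?_)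
    rw [abs_mul]
    exact mul_le_mul_of_nonneg_right (hB i τ) (abs_nonneg _)
  have heq : compensated X x f σ₀ τ - compensated X x f σ τ
      = (f (σ₀ * τ) - f (σ * τ)) - (f σ₀ - f σ)
        - ∑ i, x i τ * (lieDeriv (X i) f σ₀ - lieDeriv (X i) f σ) := by
    simp only [compensated, mul_sub, Finset.sum_sub_distrib]
    ring
  rw [heq]
  have := abs_sub ((f (σ₀ * τ) - f (σ * τ)) - (f σ₀ - f σ))
    (∑ i, x i τ * (lieDeriv (X i) f σ₀ - lieDeriv (X i) f σ))
  have := abs_sub (f (σ₀ * τ) - f (σ * τ)) (f σ₀ - f σ)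
  linarith

/-- Second order Taylor estimate: on a canonical coordinate neighbourhood the compensated increment
of `f` is bounded by a multiple of `∑ i, x i ^ 2`, uniformly in the base point. -/
lemma exists_abs_compensated_le
    {X : Module.Basis (Fin d) ℝ (GroupLieAlgebra (𝓡 d) G)} {U : Set G} {x : Fin d → G → ℝ}
    (hU : IsCanonicalNhd X U x) {f : G → ℝ} (hf : f ∈ CcSmooth d G) :
    ∃ C, ∀ σ, ∀ τ ∈ U, |compensated X x f σ τ| ≤ C * ∑ i, x i τ ^ 2 := by
  choose B hB using fun i j => (hasCompactSupport_lieDeriv (hasCompactSupport_lieDeriv hf.2 (X i))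
    (X j)).exists_bound_of_continuous (continuous_lieDeriv_lieDeriv hf (X j) (X i))
  have hB0 : ∀ i j, 0 ≤ B i j := fun i j => (norm_nonneg _).trans (hB i j 1)
  refine ⟨∑ i, ∑ j, B i j, fun σ τ hτ => ?_⟩
  obtain ⟨γ, hγ, hγ0, hγ1⟩ := hU.exp_eq τ hτ
  set v : GroupLieAlgebra (𝓡 d) G := ∑ i, x i τ • X i with hv
  set q := ∑ i, x i τ ^ 2 with hq
  set C := ∑ i, ∑ j, B i j with hC
  have hxq : ∀ i, x i τ ^ 2 ≤ q := fun i =>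
    Finset.single_le_sum (f := fun i => x i τ ^ 2) (fun i _ => sq_nonneg _) (Finset.mem_univ i)
  have hxx : ∀ i j, |x i τ| * |x j τ| ≤ q := fun i j => by
    nlinarith [hxq i, hxq j, sq_abs (x i τ), sq_abs (x j τ), sq_nonneg (|x i τ| - |x j τ|)]
  have hF : ∀ t, HasDerivAt (fun s => f (σ * γ s))
      (∑ i, x i τ * lieDeriv (X i) f (σ * γ t)) t := fun t => by
    rw [← lieDeriv_sum_smul]
    exact hasDerivAt_comp_mul_integralCurve (hf.1.mdifferentiable (by simp)) hγ σ t
  have hL : ∀ i, MDifferentiable (𝓡 d) 𝓘(ℝ, ℝ) (lieDeriv (X i) f) := fun i =>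
    (contMDiff_two_lieDeriv hf (X i)).mdifferentiable
      two_ne_zero
  have hF' : ∀ t, HasDerivAt (fun s => ∑ i, x i τ * lieDeriv (X i) f (σ * γ s))
      (∑ i, x i τ * ∑ j, x j τ * lieDeriv (X j) (lieDeriv (X i) f) (σ * γ t)) t := fun t => by
    refine HasDerivAt.fun_sum fun i _ => HasDerivAt.const_mul _ ?_
    rw [← lieDeriv_sum_smul]
    exact hasDerivAt_comp_mul_integralCurve (hL i) hγ σ t
  have hF'' : ∀ g, ‖∑ i, x i τ * ∑ j, x j τ * lieDeriv (X j) (lieDeriv (X i) f) g‖ ≤ C * q := by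
    intro g
    rw [hC, Finset.sum_mul]
    refine (norm_sum_le _ _).trans (Finset.sum_le_sum fun i _ => ?_)
    rw [Finset.mul_sum, Finset.sum_mul]
    refine (norm_sum_le _ _).trans (Finset.sum_le_sum fun j _ => ?_)
    rw [← mul_assoc, norm_mul, norm_mul, mul_comm]
    exact mul_le_mul (hB i j g) (hxx i j) (by positivity) (hB0 i j)
  have hCq : 0 ≤ C * q := (norm_nonneg _).trans (hF'' 1)
  set F' : ℝ → ℝ := fun s => ∑ i, x i τ * lieDeriv (X i) f (σ * γ s) with hF'def
  -- Two mean value inequalities replace the Taylor remainder, at the cost of the factor 1/2: one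
  -- for `F'`, then one for `f (σ * γ s) - s * F' 0`.
  have h1 : ∀ t ∈ Icc (0 : ℝ) 1, ‖F' t - F' 0‖ ≤ C * q := fun t ht => by
    have := norm_image_sub_le_of_norm_deriv_le_segment' (f := F') (a := 0) (b := 1)
      (fun s _ => (hF' s).hasDerivWithinAt) (fun s _ => hF'' _) t ht
    refine this.trans ?_
    nlinarith [ht.2]
  have h2 := norm_image_sub_le_of_norm_deriv_le_segment_01'
    (f := fun s => f (σ * γ s) - s * F' 0) (f' := fun s => F' s - F' 0)
    (fun s _ => ((hF s).sub (by simpa using (hasDerivAt_id s).mul_const (F' 0))).hasDerivWithinAt)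
    (fun s hs => h1 s (Ico_subset_Icc_self hs))
  have heq : f (σ * γ 1) - 1 * F' 0 - (f (σ * γ 0) - 0 * F' 0) = compensated X x f σ τ := by
    simp only [hF'def, hγ0, hγ1, compensated, mul_one]
    ring
  rw [heq] at h2
  exact h2

end Compensated

/-! ### Weakly continuous kernels integrated against varying integrands. -/

section WeakContinuity

variable {T G : Type*} [TopologicalSpace T] [TopologicalSpace G] [MeasurableSpace G]
  [OpensMeasurableSpace G]

lemma integrableOn_mul_of_bounded {S : Set G} (hS : MeasurableSet S) {ν : Measure G} {w h : G → ℝ}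
    (hw : IntegrableOn w S ν) (hh : ContinuousOn h S) {C : ℝ} (hC : ∀ τ ∈ S, |h τ| ≤ C) :
    IntegrableOn (fun τ => h τ * w τ) S ν :=
  Integrable.bdd_mul hw (hh.aestronglyMeasurable hS)
    ((ae_restrict_iff' hS).2 (Eventually.of_forall hC))

/-- Joint continuity of `(H, σ) ↦ ∫_S H w dν_σ` for uniform convergence of bounded continuous
integrands `H` and weakly continuous weighted measures `w ν_σ`. -/
lemma continuousAt_setIntegral_of_tendstoUniformlyOn {S : Set G} (hS : MeasurableSet S)
    {ν : T → Measure G} {w : G → ℝ} (hw0 : ∀ τ, 0 ≤ w τ) (hw : ∀ σ, IntegrableOn w S (ν σ))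
    (hν : ∀ h : G → ℝ, ContinuousOn h S → (∃ C, ∀ τ ∈ S, |h τ| ≤ C) →
      Continuous fun σ => ∫ τ in S, h τ * w τ ∂(ν σ))
    {H : T → G → ℝ} (hH : ∀ σ, ContinuousOn (H σ) S) (hb : ∀ σ, ∃ C, ∀ τ ∈ S, |H σ τ| ≤ C)
    {σ₀ : T} (hu : TendstoUniformlyOn H (H σ₀) (𝓝 σ₀) S) :
    ContinuousAt (fun σ => ∫ τ in S, H σ τ * w τ ∂(ν σ)) σ₀ := by
  have hi : ∀ σ σ', IntegrableOn (fun τ => H σ τ * w τ) S (ν σ') := fun σ σ' => by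
    obtain ⟨C, hC⟩ := hb σ
    exact integrableOn_mul_of_bounded hS (hw σ') (hH σ) hC
  have hmass : Continuous fun σ => ∫ τ in S, w τ ∂(ν σ) := by
    simpa using hν (fun _ => 1) continuousOn_const ⟨1, fun _ _ => by simp⟩
  have hdiff : Tendsto (fun σ => ∫ τ in S, (H σ τ - H σ₀ τ) * w τ ∂(ν σ)) (𝓝 σ₀) (𝓝 0) := by
    rw [Metric.tendsto_nhds]
    intro ε hε
    set m := ∫ τ in S, w τ ∂(ν σ₀)
    have hm : 0 ≤ m := integral_nonneg hw0
    -- Continuity of the total weighted mass keeps it below `m + 1` near `σ₀`, so a uniformly small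
    -- integrand has a small integral.
    filter_upwards [Metric.tendstoUniformlyOn_iff.1 hu (ε / (m + 1)) (by positivity),
      hmass.continuousAt.eventually_lt continuousAt_const (lt_add_one m)] with σ h1 h2
    have hle : ‖∫ τ in S, (H σ τ - H σ₀ τ) * w τ ∂(ν σ)‖
        ≤ ∫ τ in S, ε / (m + 1) * w τ ∂(ν σ) := by
      refine norm_integral_le_of_norm_le ((hw σ).const_mul _)
        ((ae_restrict_iff' hS).2 (Eventually.of_forall fun τ hτ => ?_))
      rw [norm_mul, Real.norm_of_nonneg (hw0 τ), norm_sub_rev, ← dist_eq_norm]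
      exact mul_le_mul_of_nonneg_right (h1 τ hτ).le (hw0 τ)
    rw [dist_zero_right]
    refine hle.trans_lt ?_
    rw [integral_const_mul, div_mul_eq_mul_div, div_lt_iff₀ (by positivity)]
    exact mul_lt_mul_of_pos_left h2 hε
  have hfix := (hν (H σ₀) (hH σ₀) (hb σ₀)).tendsto σ₀
  have hsum := hdiff.add hfix
  rw [zero_add] at hsum
  refine hsum.congr fun σ => ?_
  have hsub : IntegrableOn (fun τ => (H σ τ - H σ₀ τ) * w τ) S (ν σ) := by
    simp only [sub_mul]
    exact (hi σ σ).sub (hi σ₀ σ)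
  rw [← integral_add hsub (hi σ₀ σ)]
  exact integral_congr_ae (Eventually.of_forall fun τ => by ring)

/-- Integrands bounded by a multiple of the weight `q` may be integrated against a kernel `ν` for
which only `q ν` is weakly continuous: the set where `q` is small is negligible in the limit. -/
lemma continuousAt_setIntegral_of_abs_le {S : Set G} (hS : MeasurableSet S)
    {ν : T → Measure G} {q : G → ℝ} (hq0 : ∀ τ, 0 ≤ q τ) (hqc : Continuous q)
    (hq : ∀ σ, IntegrableOn q S (ν σ))
    (hν : ∀ h : G → ℝ, ContinuousOn h S → (∃ C, ∀ τ ∈ S, |h τ| ≤ C) →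
      Continuous fun σ => ∫ τ in S, h τ * q τ ∂(ν σ))
    {H : T → G → ℝ} (hH : ∀ σ, Continuous (H σ)) (hb : ∀ σ, ∃ C, ∀ τ, |H σ τ| ≤ C)
    {C : ℝ} (hC : ∀ σ, ∀ τ ∈ S, |H σ τ| ≤ C * q τ)
    {σ₀ : T} (hu : TendstoUniformly H (H σ₀) (𝓝 σ₀)) :
    ContinuousAt (fun σ => ∫ τ in S, H σ τ ∂(ν σ)) σ₀ := by
  -- `H / q` need not be continuous, nor converge uniformly, near the zeros of `q`; dividing by `max
  -- q δ` cures both.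
  have hmax : ∀ δ > 0, ∀ τ, 0 < max (q τ) δ := fun δ hδ τ => lt_max_of_lt_right hδ
  have hcut : ∀ δ > 0, Continuous fun τ => 1 - q τ / max (q τ) δ := fun δ hδ =>
    continuous_const.sub (hqc.div (hqc.max continuous_const) fun τ => (hmax δ hδ τ).ne')
  have hcut0 : ∀ δ > 0, ∀ τ, 0 ≤ 1 - q τ / max (q τ) δ := fun δ hδ τ => by
    rw [sub_nonneg, div_le_one (hmax δ hδ τ)]
    exact le_max_left _ _
  have hcut1 : ∀ δ > 0, ∀ τ, |1 - q τ / max (q τ) δ| ≤ 1 := fun δ hδ τ => by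
    rw [abs_of_nonneg (hcut0 δ hδ τ), sub_le_self_iff]
    exact div_nonneg (hq0 τ) (hmax δ hδ τ).le
  have hHi : ∀ σ, IntegrableOn (H σ) S (ν σ) := fun σ =>
    Integrable.mono' ((hq σ).const_mul C) (hH σ).aestronglyMeasurable
      ((ae_restrict_iff' hS).2 (Eventually.of_forall (hC σ)))
  have hmain : ∀ δ > 0, ContinuousAt
      (fun σ => ∫ τ in S, H σ τ / max (q τ) δ * q τ ∂(ν σ)) σ₀ := by
    intro δ hδ
    refine continuousAt_setIntegral_of_tendstoUniformlyOn hS hq0 hq hν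
      (H := fun σ τ => H σ τ / max (q τ) δ) (fun σ => ?_) (fun σ => ?_) ?_
    · exact ((hH σ).div (hqc.max continuous_const) fun τ => (hmax δ hδ τ).ne').continuousOn
    · obtain ⟨B, hB⟩ := hb σ
      refine ⟨B / δ, fun τ _ => ?_⟩
      rw [abs_div, abs_of_pos (hmax δ hδ τ)]
      exact div_le_div₀ ((abs_nonneg _).trans (hB τ)) (hB τ) hδ (le_max_right _ _)
    · rw [Metric.tendstoUniformlyOn_iff]
      intro ε hε
      filter_upwards [Metric.tendstoUniformly_iff.1 hu (ε * δ) (by positivity)] with σ h τ _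
      rw [Real.dist_eq, ← sub_div, abs_div, abs_of_pos (hmax δ hδ τ), div_lt_iff₀ (hmax δ hδ τ)]
      exact (h τ).trans_le (mul_le_mul_of_nonneg_left (le_max_right _ _) hε.le)
  have hrest : ∀ δ > 0, ∀ σ,
      |∫ τ in S, H σ τ ∂(ν σ) - ∫ τ in S, H σ τ / max (q τ) δ * q τ ∂(ν σ)|
        ≤ C * ∫ τ in S, (1 - q τ / max (q τ) δ) * q τ ∂(ν σ) := by
    intro δ hδ σ
    obtain ⟨B, hB⟩ := hb σ
    have hqi := integrableOn_mul_of_bounded hS (hq σ) (hcut δ hδ).continuousOn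
      fun τ _ => hcut1 δ hδ τ
    have heq : ∀ τ, H σ τ / max (q τ) δ * q τ = q τ / max (q τ) δ * H σ τ := fun τ => by ring
    have hi2 : IntegrableOn (fun τ => H σ τ / max (q τ) δ * q τ) S (ν σ) := by
      simp only [heq]
      refine integrableOn_mul_of_bounded hS (hHi σ)
        (hqc.div (hqc.max continuous_const) fun τ => (hmax δ hδ τ).ne').continuousOn
        (C := 1) fun τ _ => ?_
      rw [abs_of_nonneg (div_nonneg (hq0 τ) (hmax δ hδ τ).le), div_le_one (hmax δ hδ τ)]
      exact le_max_left _ _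
    rw [← integral_sub (hHi σ) hi2, ← integral_const_mul]
    rw [← Real.norm_eq_abs]
    refine norm_integral_le_of_norm_le (Integrable.const_mul hqi C)
      ((ae_restrict_iff' hS).2 (Eventually.of_forall fun τ hτ => ?_))
    rw [heq, ← one_sub_mul, norm_mul, Real.norm_of_nonneg (hcut0 δ hδ τ), mul_left_comm]
    exact mul_le_mul_of_nonneg_left (hC σ τ hτ) (hcut0 δ hδ τ)
  have hsmall : Tendsto (fun n : ℕ => C * ∫ τ in S, (1 - q τ / max (q τ) (1 / (n + 1 : ℝ))) * q τ
      ∂(ν σ₀)) atTop (𝓝 0) := by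
    rw [← mul_zero C, ← integral_zero (μ := (ν σ₀).restrict S) G ℝ]
    apply Tendsto.const_mul
    refine tendsto_integral_of_dominated_convergence q
      (fun n => ((hcut _ Nat.one_div_pos_of_nat).mul hqc).aestronglyMeasurable) (hq σ₀)
      (fun n => Eventually.of_forall fun τ => ?_) (Eventually.of_forall fun τ => ?_)
    · rw [norm_mul, Real.norm_of_nonneg (hq0 τ)]
      exact mul_le_of_le_one_left (hq0 τ) (hcut1 _ Nat.one_div_pos_of_nat τ)
    · rcases (hq0 τ).eq_or_lt with h | h
      · simp [← h]
      · refine tendsto_const_nhds.congr' ?_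
        filter_upwards [(tendsto_one_div_add_atTop_nhds_zero_nat (𝕜 := ℝ)).eventually_lt_const h]
          with n hn
        rw [max_eq_left hn.le, div_self h.ne', sub_self, zero_mul]
  rw [Metric.continuousAt_iff']
  intro ε hε
  obtain ⟨n, hn⟩ := (hsmall.eventually_lt_const (show 0 < ε / 4 by positivity)).exists
  have hδ : (0 : ℝ) < 1 / (n + 1 : ℝ) := Nat.one_div_pos_of_nat
  set δ := 1 / (n + 1 : ℝ)
  -- For fixed `δ` the error bound is itself continuous in `σ`, so a `δ` chosen at `σ₀` works on a
  -- whole neighbourhood.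
  have hR := continuous_const.mul
    (hν _ (hcut δ hδ).continuousOn ⟨1, fun τ _ => hcut1 δ hδ τ⟩) (f := fun _ : T => C)
  filter_upwards [Metric.continuousAt_iff'.1 (hmain δ hδ) (ε / 4) (by positivity),
    hR.continuousAt.eventually_lt continuousAt_const hn] with σ h1 h2
  have h3 := (hrest δ hδ σ).trans_lt h2
  have h4 := (hrest δ hδ σ₀).trans_lt hn
  rw [Real.dist_eq] at h1 ⊢
  rw [abs_lt] at h1 h3 h4 ⊢
  constructor <;> linarith [h1.1, h1.2, h3.1, h3.2, h4.1, h4.2]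

end WeakContinuity

/-! ### The integral term of the Courrège form. -/

section CourregeForm

variable {d : ℕ} {G : Type*} [TopologicalSpace G] [ChartedSpace (EuclideanSpace ℝ (Fin d)) G]
  [Group G] [MeasurableSpace G] [BorelSpace G]

lemma LieCourrege.IsLevyMeasure.integrableOn_sum_sq
    {X : Module.Basis (Fin d) ℝ (GroupLieAlgebra (𝓡 d) G)} {μ : Measure G}
    (hμ : IsLevyMeasure X μ) {U : Set G} {x : Fin d → G → ℝ} (hU : IsCanonicalNhd X U x) :
    IntegrableOn (fun τ => ∑ i, x i τ ^ 2) U μ := by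
  have hx := hU.continuous_coord
  have hc : Continuous fun τ => ∑ i, x i τ ^ 2 := by fun_prop
  refine ⟨hc.aestronglyMeasurable, ?_⟩
  rw [hasFiniteIntegral_iff_ofReal
    (Eventually.of_forall fun τ => Finset.sum_nonneg fun i _ => sq_nonneg _)]
  exact hμ.lintegral_lt_top U x hU

variable [LieGroup (𝓡 d) ∞ G]

lemma integrable_compensated
    {X : Module.Basis (Fin d) ℝ (GroupLieAlgebra (𝓡 d) G)} {μ : Measure G}
    (hμ : IsLevyMeasure X μ) {U : Set G} {x : Fin d → G → ℝ} (hU : IsCanonicalNhd X U x)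
    {f : G → ℝ} (hf : f ∈ CcSmooth d G) (σ : G) : Integrable (compensated X x f σ) μ := by
  have : IsTopologicalGroup G := topologicalGroup_of_lieGroup (𝓡 d) ∞
  have hm := (continuous_compensated hU hf σ).aestronglyMeasurable (μ := μ)
  obtain ⟨C, hC⟩ := exists_abs_compensated_le hU hf
  obtain ⟨B, hB⟩ := exists_bound_compensated hU hf σ
  rw [← integrableOn_univ, ← union_compl_self U]
  refine IntegrableOn.union ?_ ?_
  · exact Integrable.mono' ((hμ.integrableOn_sum_sq hU).const_mul C) hm.restrict
      ((ae_restrict_iff' hU.isOpen.measurableSet).2 (Eventually.of_forall (hC σ)))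
  · exact Measure.integrableOn_of_bounded (hμ.compl_lt_top U x hU).ne hm
      (Eventually.of_forall hB)

lemma continuous_integral_compensated
    {X : Module.Basis (Fin d) ℝ (GroupLieAlgebra (𝓡 d) G)} {μ : G → Measure G}
    (hμ : ∀ σ, IsLevyMeasure X (μ σ)) {U : Set G} {x : Fin d → G → ℝ} (hU : IsCanonicalNhd X U x)
    (hw : WeaklyContinuousKernel U x μ) {f : G → ℝ} (hf : f ∈ CcSmooth d G) :
    Continuous fun σ => ∫ τ, compensated X x f σ τ ∂(μ σ) := by
  have : IsTopologicalGroup G := topologicalGroup_of_lieGroup (𝓡 d) ∞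
  have hx := hU.continuous_coord
  have hUm := hU.isOpen.measurableSet
  obtain ⟨C, hC⟩ := exists_abs_compensated_le hU hf
  have hcont := continuous_compensated hU hf
  have hbd := exists_bound_compensated hU hf
  rw [continuous_iff_continuousAt]
  intro σ₀
  have hu := tendstoUniformly_compensated hU hf σ₀
  have h1 : ContinuousAt (fun σ => ∫ τ in U, compensated X x f σ τ ∂(μ σ)) σ₀ :=
    continuousAt_setIntegral_of_abs_le hUm
      (fun τ => Finset.sum_nonneg fun i _ => sq_nonneg (x i τ)) (by fun_prop)
      (fun σ => (hμ σ).integrableOn_sum_sq hU) hw.1 hcont hbd hC hu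
  -- Off `U` the Lévy measures are finite, so the constant weight `1` is admissible.
  have h2 : ContinuousAt (fun σ => ∫ τ in Uᶜ, compensated X x f σ τ * 1 ∂(μ σ)) σ₀ :=
    continuousAt_setIntegral_of_tendstoUniformlyOn hUm.compl (w := fun _ => 1)
      (fun _ => zero_le_one) (fun σ => integrableOn_const ((hμ σ).compl_lt_top U x hU).ne)
      (by simpa only [mul_one] using hw.2) (fun σ => (hcont σ).continuousOn)
      (fun σ => (hbd σ).imp fun _ h τ _ => h τ) hu.tendstoUniformlyOn
  simp only [mul_one] at h2
  refine (h1.add h2).congr (Eventually.of_forall fun σ => ?_)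
  exact integral_add_compl hUm (integrable_compensated (hμ σ) hU hf σ)

/-- Off the support of `f`, and when all `U`-jumps from `σ` stay off the support, only the jumps
outside `U` contribute. -/
lemma LieCourrege.IsCourregeForm.abs_apply_le
    {X : Module.Basis (Fin d) ℝ (GroupLieAlgebra (𝓡 d) G)} {U : Set G} {x : Fin d → G → ℝ}
    {A : CcSmooth d G →ₗ[ℝ] (G → ℝ)} {c : G → ℝ} {b : G → Fin d → ℝ}
    {a : G → Matrix (Fin d) (Fin d) ℝ} {μ : G → Measure G}
    (hform : IsCourregeForm X x A c b a μ) (hU : IsCanonicalNhd X U x) (f : CcSmooth d G)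
    {B : ℝ} (hB : ∀ g, |(f : G → ℝ) g| ≤ B) {σ : G} (hσ : σ ∉ tsupport (f : G → ℝ))
    (hσU : ∀ τ ∈ U, σ * τ ∉ tsupport (f : G → ℝ)) :
    |A f σ| ≤ B * (μ σ Uᶜ).toReal := by
  have h0 : (f : G → ℝ) σ = 0 := image_eq_zero_of_notMem_tsupport hσ
  have h1 : ∀ i, σ ∉ tsupport (lieDeriv (X i) (f : G → ℝ)) := fun i h =>
    hσ (tsupport_lieDeriv_subset _ _ h)
  have h1' : ∀ i, lieDeriv (X i) (f : G → ℝ) σ = 0 := fun i =>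
    image_eq_zero_of_notMem_tsupport (h1 i)
  have h2 : ∀ i j, lieDeriv (X j) (lieDeriv (X i) (f : G → ℝ)) σ = 0 := fun i j =>
    image_eq_zero_of_notMem_tsupport fun h => h1 i (tsupport_lieDeriv_subset _ _ h)
  have hcomp : ∀ τ, compensated X x (f : G → ℝ) σ τ = (f : G → ℝ) (σ * τ) := fun τ => by
    simp [compensated, h0, h1']
  have hint := integrable_compensated (hform.levy σ) hU f.2 σ
  rw [hform.apply_eq, ← integral_add_compl hU.isOpen.measurableSet hint,
    setIntegral_eq_zero_of_forall_eq_zero fun τ hτ => by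
      rw [hcomp, image_eq_zero_of_notMem_tsupport (hσU τ hτ)]]
  simp only [h0, h1', h2, mul_zero, Finset.sum_const_zero, zero_add]
  simp only [hcomp]
  exact norm_setIntegral_le_of_norm_le_const (f := fun τ => (f : G → ℝ) (σ * τ))
    ((hform.levy σ).compl_lt_top U x hU) fun τ _ => hB _

end CourregeForm

/-! ### Assembly of the three conclusions. -/

theorem mainTheorem8 {d : ℕ} {G : Type*} [TopologicalSpace G] [T2Space G]
    [ChartedSpace (EuclideanSpace ℝ (Fin d)) G] [Group G] [LieGroup (𝓡 d) ∞ G]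
    [MeasurableSpace G] [BorelSpace G]
    (X : Module.Basis (Fin d) ℝ (GroupLieAlgebra (𝓡 d) G))
    (U : Set G) (x : Fin d → G → ℝ) (hU : IsCanonicalNhd X U x)
    (A : CcSmooth d G →ₗ[ℝ] (G → ℝ)) (hA : PositiveMaximumPrinciple A)
    (c : G → ℝ) (b : G → Fin d → ℝ) (a : G → Matrix (Fin d) (Fin d) ℝ)
    (μ : G → MeasureTheory.Measure G) (hform : IsCourregeForm X x A c b a μ) :
    (ContinuousCoefficients c b a → WeaklyContinuousKernel U x μ →
      ∀ f : CcSmooth d G, Continuous (A f)) ∧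
    (JumpMassVanishes U μ →
      ∀ f : CcSmooth d G, Filter.Tendsto (A f) (Filter.cocompact G) (𝓝 0)) ∧
    (ContinuousCoefficients c b a → WeaklyContinuousKernel U x μ → JumpMassVanishes U μ →
      ∀ f : CcSmooth d G, ∃ F : C₀(G, ℝ), (F : G → ℝ) = A f) := by
  have hcont : ContinuousCoefficients c b a → WeaklyContinuousKernel U x μ →
      ∀ f : CcSmooth d G, Continuous (A f) := by
    rintro ⟨hc, hb, ha⟩ hw f
    have h0 : Continuous (f : G → ℝ) := f.2.1.continuous
    have h1 := fun i => continuous_lieDeriv f.2 (X i)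
    have h2 := fun i j => continuous_lieDeriv_lieDeriv f.2 (X i) (X j)
    have h3 := continuous_integral_compensated hform.levy hU hw f.2
    rw [funext (hform.apply_eq f)]
    fun_prop
  have hvan : JumpMassVanishes U μ →
      ∀ f : CcSmooth d G, Tendsto (A f) (cocompact G) (𝓝 0) := by
    intro hj f
    have : IsTopologicalGroup G := topologicalGroup_of_lieGroup (𝓡 d) ∞
    obtain ⟨B, hB⟩ := exists_bound_of_mem_CcSmooth f.2
    obtain ⟨K, hK, hUK⟩ := hU.exists_isCompact_superset
    have hreal : Tendsto (fun σ => B * (μ σ Uᶜ).toReal) (cocompact G) (𝓝 0) := by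
      simpa using ((ENNReal.tendsto_toReal ENNReal.zero_ne_top).comp hj).const_mul B
    -- Any `σ` with `σ * τ` in the support for some `τ ∈ U` lies in this compact set; `τ = 1` covers
    -- `σ` itself.
    have hS : IsCompact ((fun p : G × G => p.1 * p.2⁻¹) '' (tsupport (f : G → ℝ) ×ˢ K)) :=
      (IsCompact.prod f.2.2 hK).image (by fun_prop)
    refine squeeze_zero_norm' ?_ hreal
    filter_upwards [hS.compl_mem_cocompact] with σ hσ
    have hσU : ∀ τ ∈ U, σ * τ ∉ tsupport (f : G → ℝ) := fun τ hτ h =>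
      hσ ⟨(σ * τ, τ), ⟨h, hUK hτ⟩, mul_inv_cancel_right σ τ⟩
    exact hform.abs_apply_le hU f hB (by simpa using hσU 1 hU.one_mem) hσU
  exact ⟨hcont, hvan, fun hco hw hj f => ⟨⟨⟨A f, hcont hco hw f⟩, hvan hj f⟩, rfl⟩⟩
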